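/- Let $k$ be an algebraically closed field of characteristic $0$, let $A$ be a finitely generated commutative associative unital $k$-algebra, $X=\operatorname{Spec}A$, and let $X_{\mathrm{rat}}$ be the set of $k$-rational points of $X$. Let $\mathfrak g$ be a finite-dimensional reductive Lie algebra over $k$, and let $\Gamma$ be a finite group acting on $X$ (equivalently, on $A$) and on $\mathfrak g$ by automorphisms. Let $\mathfrak M=(\mathfrak g\otimes_k A)^\Gamma$ be the equivariant map algebra, i.e. the Lie algebra of $\Gamma$-equivariant regular maps $X\to\mathfrak g$. For $x\in X_{\mathrm{rat}}$ let $\mathfrak g^x$ be the subalgebra of elements of $\mathfrak g$ fixed by the isotropy group $\Gamma_x=\{\gamma\in\Gamma:\gamma\cdot x=x\}$. Given a finite set $\mathbf x\subseteq X_{\mathrm{rat}}$ whose distinct points lie in distinct $\Gamma$-orbits, and finite-dimensional representations $\rho_x:\mathfrak g^x\to\operatorname{End}_k V_x$ for $x\in\mathbf x$, the associated evaluation representation of $\mathfrak M$ is the composition $$\mathfrak M\xrightarrow{\ \alpha\mapsto(\alpha(x))_{x\in\mathbf x}\ }\prod_{x\in\mathbf x}\mathfrak g^x\xrightarrow{\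 \bigotimes_{x\in\mathbf x}\rho_x\ }\operatorname{End}_k\Big(\bigotimes_{x\in\mathbf x}V_x\Big),$$ where $(l_x)_{x}$ acts on the tensor product by $\sum_{x\in\mathbf x}\mathrm{id}\otimes\cdots\otimes\rho_x(l_x)\otimes\cdots\otimes\mathrm{id}$. Its support is the union of the orbits $\Gamma\cdot x$ over those $x\in\mathbf x$ for which $\rho_x$ is not the one-dimensional trivial representation of $\mathfrak g^x$. If $V_1,V_2$ are nontrivial irreducible evaluation representations of $\mathfrak M$ with disjoint supports, then $\operatorname{Ext}^1_{\mathfrak M}(V_1,V_2)=0$. Here $\operatorname{Ext}^1_{\mathfrak M}(V_1,V_2)$ is the set of equivalence classes of short exact sequences of $\mathfrak M$-modules $0\to V_2\to U\to V_1\to 0$, and its zero element is the class of the split sequence; so every such sequence splits. -/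

import Mathlib

open scoped TensorProduct

noncomputable section

/-! ### Extensions of Lie algebra modules -/

section Extensions

universe uV uW

variable (k L : Type*) [Field k] [LieRing L] [LieAlgebra k L]
variable (V : Type uV) [AddCommGroup V] [Module k V] [LieRingModule L V] [LieModule k L V]
variable (W : Type uW) [AddCommGroup W] [Module k W] [LieRingModule L W] [LieModule k L W]

/-- The componentwise action of `L` on the direct sum of two `L`-modules. -/
instance LieModule.prodLieRingModule : LieRingModule L (V × W) where
  bracket l p := (⁅l, p.1⁆, ⁅l, p.2⁆)
  add_lie _ _ _ := Prod.ext (add_lie _ _ _) (add_lie _ _ _)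
  lie_add _ _ _ := Prod.ext (lie_add _ _ _) (lie_add _ _ _)
  leibniz_lie _ _ _ := Prod.ext (leibniz_lie _ _ _) (leibniz_lie _ _ _)

instance LieModule.prodLieModule : LieModule k L (V × W) where
  smul_lie _ _ _ := Prod.ext (smul_lie _ _ _) (smul_lie _ _ _)
  lie_smul _ _ _ := Prod.ext (lie_smul _ _ _) (lie_smul _ _ _)

/-- An extension of `V` by `W`: a short exact sequence `0 → W → U → V → 0` of `L`-modules. -/
structure LieModExt where
  /-- the middle term -/
  U : Type (max uV uW)
  [instAddCommGroup : AddCommGroup U]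
  [instModule : Module k U]
  [instLieRingModule : LieRingModule L U]
  [instLieModule : LieModule k L U]
  /-- the inclusion of `W` -/
  incl : W →ₗ⁅k,L⁆ U
  /-- the projection onto `V` -/
  proj : U →ₗ⁅k,L⁆ V
  incl_injective : Function.Injective incl
  proj_surjective : Function.Surjective proj
  exact : Function.Exact incl proj

attribute [instance] LieModExt.instAddCommGroup LieModExt.instModule
  LieModExt.instLieRingModule LieModExt.instLieModule

namespace LieModExt

variable {k L V W}

/-- Equivalence of extensions: an isomorphism of the middle terms inducing the identity on
`W` and on `V`. -/
def Equivalent (E F : LieModExt k L V W) : Prop :=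
  ∃ e : E.U ≃ₗ⁅k,L⁆ F.U, (∀ w, e (E.incl w) = F.incl w) ∧ ∀ u, F.proj (e u) = E.proj u

theorem equivalent_equivalence : Equivalence (Equivalent (k := k) (L := L) (V := V) (W := W)) where
  refl _ := ⟨LieModuleEquiv.refl, fun _ => rfl, fun _ => rfl⟩
  symm := by
    rintro E F ⟨e, h₁, h₂⟩
    refine ⟨e.symm, fun w => ?_, fun u => ?_⟩
    · rw [← h₁, LieModuleEquiv.symm_apply_apply]
    · rw [← h₂, LieModuleEquiv.apply_symm_apply]
  trans := by
    rintro E F G ⟨e, h₁, h₂⟩ ⟨f, h₃, h₄⟩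
    refine ⟨e.trans f, fun w => ?_, fun u => ?_⟩
    · rw [LieModuleEquiv.trans_apply, h₁, h₃]
    · rw [LieModuleEquiv.trans_apply, h₄, h₂]

instance setoid : Setoid (LieModExt k L V W) := ⟨Equivalent, equivalent_equivalence⟩

variable (k L V W) in
/-- The split extension `0 → W → V ⊕ W → V → 0`. -/
def split : LieModExt k L V W where
  U := V × W
  incl := { LinearMap.inr k V W with map_lie' := fun {_ _} => Prod.ext (lie_zero _).symm rfl }
  proj := { LinearMap.fst k V W with map_lie' := rfl }
  incl_injective _ _ h := congrArg Prod.snd h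
  proj_surjective v := ⟨(v, 0), rfl⟩
  exact u := ⟨fun h => ⟨u.2, Prod.ext (Eq.symm h) rfl⟩, by rintro ⟨w, rfl⟩; rfl⟩

end LieModExt

/-- `Ext¹_L(V, W)`: the set of equivalence classes of extensions `0 → W → U → V → 0`, pointed by
the class of the split extension, which is the zero of `Ext¹`. -/
def LieExtOne : Type _ := Quotient (LieModExt.setoid (k := k) (L := L) (V := V) (W := W))

instance LieExtOne.instZero : Zero (LieExtOne k L V W) := ⟨Quotient.mk _ (LieModExt.split k L V W)⟩

end Extensions

/-! ### Direct products of Lie algebras and outer tensor products of their modules -/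

section OuterTensor

attribute [local instance 100] LieRing.ofAssociativeRing

variable {ι : Type*}

/-- The direct product of a family of Lie algebras, with componentwise bracket. -/
instance Pi.prodLieRing (L : ι → Type*) [∀ i, LieRing (L i)] : LieRing (∀ i, L i) where
  bracket x y := fun i => ⁅x i, y i⁆
  add_lie _ _ _ := funext fun _ => add_lie _ _ _
  lie_add _ _ _ := funext fun _ => lie_add _ _ _
  lie_self _ := funext fun _ => lie_self _
  leibniz_lie _ _ _ := funext fun _ => leibniz_lie _ _ _

instance Pi.prodLieAlgebra (k : Type*) [CommRing k] (L : ι → Type*) [∀ i, LieRing (L i)]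
    [∀ i, LieAlgebra k (L i)] : LieAlgebra k (∀ i, L i) where
  lie_smul _ _ _ := funext fun _ => lie_smul _ _ _

variable (k : Type*) [Field k] (L : ι → Type*) [∀ i, LieRing (L i)]
  [∀ i, LieAlgebra k (L i)] (V : ι → Type*) [∀ i, AddCommGroup (V i)] [∀ i, Module k (V i)]
  [∀ i, LieRingModule (L i) (V i)] [∀ i, LieModule k (L i) (V i)]

/-- The endomorphism `id ⊗ ⋯ ⊗ f ⊗ ⋯ ⊗ id` of `⨂ Vᵢ`, with `f` acting in position `i`. -/
def PiTensorProduct.mapAt (i : ι) (f : Module.End k (V i)) : Module.End k (⨂[k] j, V j) :=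
  open Classical in
  PiTensorProduct.map (Function.update (fun _ => LinearMap.id) i f)

variable {V} in
theorem PiTensorProduct.mapAt_mul (i : ι) (f g : Module.End k (V i)) :
    mapAt k V i (f * g) = mapAt k V i f * mapAt k V i g := by
  classical
  unfold mapAt
  rw [← PiTensorProduct.map_mul]
  congr 1
  funext j
  by_cases h : j = i
  · subst h; simp
  · simp [Function.update_of_ne h]; rfl

variable {V} in
theorem PiTensorProduct.mapAt_comm {i j : ι} (h : i ≠ j) (f : Module.End k (V i))
    (g : Module.End k (V j)) : mapAt k V i f * mapAt k V j g = mapAt k V j g * mapAt k V i f := by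
  classical
  unfold mapAt
  rw [← PiTensorProduct.map_mul, ← PiTensorProduct.map_mul]
  congr 1
  funext l
  by_cases hi : l = i
  · subst hi; simp [Function.update_of_ne h]; rfl
  · by_cases hj : l = j
    · subst hj; simp [Function.update_of_ne hi]; rfl
    · simp [Function.update_of_ne hi, Function.update_of_ne hj]

variable [Fintype ι]

/-- The outer tensor product representation of `∏ Lᵢ` on `⨂ Vᵢ`:
`(lᵢ)ᵢ` acts by `∑ᵢ id ⊗ ⋯ ⊗ lᵢ ⊗ ⋯ ⊗ id`. -/
def outerTensorRep : (∀ i, L i) →ₗ⁅k⁆ Module.End k (⨂[k] i, V i) where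
  toFun l := ∑ i, PiTensorProduct.mapAt k V i (LieModule.toEnd k (L i) (V i) (l i))
  map_add' l m := by
    rw [← Finset.sum_add_distrib]
    refine Finset.sum_congr rfl fun i _ => ?_
    rw [Pi.add_apply, map_add]
    classical exact PiTensorProduct.map_update_add _ _ _ _
  map_smul' c l := by
    rw [RingHom.id_apply, Finset.smul_sum]
    refine Finset.sum_congr rfl fun i _ => ?_
    rw [Pi.smul_apply, map_smul]
    classical exact PiTensorProduct.map_update_smul _ _ _ _
  map_lie' {l m} := by
    classical
    have hsub (i : ι) (f g : Module.End k (V i)) : PiTensorProduct.mapAt k V i (f - g)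
        = PiTensorProduct.mapAt k V i f - PiTensorProduct.mapAt k V i g :=
      (PiTensorProduct.mapMultilinear k V V).map_update_sub _ _ _ _
    have h : ∀ i, PiTensorProduct.mapAt k V i (LieModule.toEnd k (L i) (V i) (⁅l, m⁆ i)) =
        ∑ j, ⁅PiTensorProduct.mapAt k V i (LieModule.toEnd k (L i) (V i) (l i)),
          PiTensorProduct.mapAt k V j (LieModule.toEnd k (L j) (V j) (m j))⁆ := by
      intro i
      rw [Finset.sum_eq_single i]
      · change PiTensorProduct.mapAt k V i (LieModule.toEnd k (L i) (V i) ⁅l i, m i⁆) = _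
        rw [LieHom.map_lie, Ring.lie_def, Ring.lie_def, hsub, PiTensorProduct.mapAt_mul,
          PiTensorProduct.mapAt_mul]
      · intro j _ hj
        rw [Ring.lie_def, PiTensorProduct.mapAt_comm k hj.symm, sub_self]
      · simp
    simp only [h, Ring.lie_def, Finset.sum_mul_sum, Finset.sum_sub_distrib]
    rw [Finset.sum_comm (f := fun i j => PiTensorProduct.mapAt k V j _ * _)]

end OuterTensor

/-! ### Equivariant map algebras -/

section EquivariantMapAlgebra

attribute [local instance 100] LieRing.ofAssociativeRing

/-- The group `Γ` acts on the Lie algebra `𝔤` by maps preserving the bracket. -/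
class LieMulAction (Γ 𝔤 : Type*) [Group Γ] [LieRing 𝔤] [DistribMulAction Γ 𝔤] : Prop where
  smul_lie_smul : ∀ (γ : Γ) (u v : 𝔤), γ • ⁅u, v⁆ = ⁅γ • u, γ • v⁆

variable (k Γ A 𝔤 : Type*) [Field k] [Group Γ]
  [CommRing A] [Algebra k A] [MulSemiringAction Γ A] [SMulCommClass Γ k A]
  [LieRing 𝔤] [LieAlgebra k 𝔤] [DistribMulAction Γ 𝔤] [SMulCommClass Γ k 𝔤] [LieMulAction Γ 𝔤]

/-- The `k`-rational points of `X = Spec A`. -/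
abbrev RatPoint : Type _ := A →ₐ[k] k

variable {k A} in
/-- The action of `Γ` on rational points: `(γ · x)(a) = x(γ⁻¹ · a)`. -/
def ratPointAct (γ : Γ) (x : RatPoint k A) : RatPoint k A :=
  x.comp (MulSemiringAction.toAlgHom k A γ⁻¹)

variable {Γ} in
/-- The automorphism of `𝔤` given by `γ`. -/
def lieActHom (γ : Γ) : 𝔤 →ₗ⁅k⁆ 𝔤 :=
  { DistribSMul.toLinearMap k 𝔤 γ with map_lie' := LieMulAction.smul_lie_smul γ _ _ }

variable {Γ} in
/-- The diagonal action of `γ` on `M(X, 𝔤) = A ⊗ 𝔤`: `γ · (a ⊗ u) = (γ · a) ⊗ (γ · u)`. -/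
def mapAlgebraAct (γ : Γ) : A ⊗[k] 𝔤 →ₗ⁅k⁆ A ⊗[k] 𝔤 :=
  LieAlgebra.ExtendScalars.map (MulSemiringAction.toAlgHom k A γ) (lieActHom k 𝔤 γ)

/-- The equivariant map algebra `M(X, 𝔤)^Γ = (A ⊗ 𝔤)^Γ`, where `X = Spec A`. -/
def EquivariantMapAlgebra : LieSubalgebra k (A ⊗[k] 𝔤) where
  carrier := {α | ∀ γ : Γ, mapAlgebraAct k A 𝔤 γ α = α}
  zero_mem' _ := map_zero _
  add_mem' ha hb γ := by rw [map_add, ha γ, hb γ]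
  smul_mem' c _ ha γ := by rw [map_smul, ha γ]
  lie_mem' ha hb γ := by rw [LieHom.map_lie, ha γ, hb γ]

variable {k A} in
/-- The subalgebra `𝔤^x` of elements of `𝔤` fixed by the isotropy group
`Γ_x = {γ | γ · x = x}`. -/
def isotropyFixed (x : RatPoint k A) : LieSubalgebra k 𝔤 where
  carrier := {u | ∀ γ : Γ, ratPointAct Γ γ x = x → γ • u = u}
  zero_mem' _ _ := smul_zero _
  add_mem' ha hb γ h := by rw [smul_add, ha γ h, hb γ h]
  smul_mem' c u ha γ h := by rw [smul_comm, ha γ h]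
  lie_mem' ha hb γ h := by rw [LieMulAction.smul_lie_smul, ha γ h, hb γ h]

variable {k A} in
/-- Evaluation `M(X, 𝔤) → 𝔤` at a rational point: `a ⊗ u ↦ a(x) u`. -/
def evalPoint (x : RatPoint k A) : A ⊗[k] 𝔤 →ₗ⁅k⁆ 𝔤 :=
  { TensorProduct.lift ((LinearMap.lsmul k 𝔤).comp x.toLinearMap) with
    map_lie' := by
      intro α β
      simp only [AddHom.toFun_eq_coe, LinearMap.coe_toAddHom]
      induction α with
      | zero => simp
      | add α₁ α₂ h₁ h₂ => simp only [add_lie, map_add, h₁, h₂]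
      | tmul a u =>
        induction β with
        | zero => simp
        | add β₁ β₂ h₁ h₂ => simp only [lie_add, map_add, h₁, h₂]
        | tmul b v => simp [mul_smul, smul_comm (x b) (x a)] }

variable {k A 𝔤} in
theorem evalPoint_tmul (x : RatPoint k A) (a : A) (u : 𝔤) :
    evalPoint 𝔤 x (a ⊗ₜ[k] u) = x a • u := rfl

variable {k A 𝔤} in
theorem evalPoint_ratPointAct (γ : Γ) (x : RatPoint k A) (α : A ⊗[k] 𝔤) :
    evalPoint 𝔤 (ratPointAct Γ γ x) (mapAlgebraAct k A 𝔤 γ α) = γ • evalPoint 𝔤 x α := by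
  induction α with
  | zero => simp
  | add α₁ α₂ h₁ h₂ => rw [map_add, map_add, h₁, h₂, map_add, smul_add]
  | tmul a u =>
    have h : mapAlgebraAct k A 𝔤 γ (a ⊗ₜ[k] u) = (γ • a) ⊗ₜ[k] (γ • u) := rfl
    rw [h, evalPoint_tmul, evalPoint_tmul, smul_comm γ (x a) u]
    congr 1
    change x (γ⁻¹ • γ • a) = x a
    rw [inv_smul_smul]

/-- The evaluation map `ev_𝐱 : M(X, 𝔤)^Γ → 𝔤^𝐱 = ∏_{x ∈ 𝐱} 𝔤^x` at a finite set of rational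
points. -/
def evalMap (s : Finset (RatPoint k A)) :
    EquivariantMapAlgebra k Γ A 𝔤 →ₗ⁅k⁆ (∀ x : s, isotropyFixed Γ 𝔤 x.1) where
  toFun α := fun x => ⟨evalPoint 𝔤 x.1 α.1, fun γ h => by
    conv_rhs => rw [← α.2 γ, ← h]
    exact (evalPoint_ratPointAct Γ γ x.1 α.1).symm⟩
  map_add' α β := funext fun x => Subtype.ext (map_add (evalPoint 𝔤 x.1) α.1 β.1)
  map_smul' c α := funext fun x => Subtype.ext (map_smul (evalPoint 𝔤 x.1) c α.1)
  map_lie' {α β} := funext fun x => Subtype.ext (LieHom.map_lie (evalPoint 𝔤 x.1) α.1 β.1)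

variable {k A} in
/-- Membership in `X_*`: distinct points of the finite set `s` lie in distinct `Γ`-orbits. -/
def OrbitDistinct (s : Finset (RatPoint k A)) : Prop :=
  ∀ x ∈ s, ∀ y ∈ s, (∃ γ : Γ, ratPointAct Γ γ x = y) → x = y

variable (s : Finset (RatPoint k A)) (V : s → Type*) [∀ x, AddCommGroup (V x)]
  [∀ x, Module k (V x)] [∀ x : s, LieRingModule (isotropyFixed Γ 𝔤 x.1) (V x)]
  [∀ x : s, LieModule k (isotropyFixed Γ 𝔤 x.1) (V x)]

/-- The evaluation representation `ev_𝐱(ρ_x)_{x ∈ 𝐱}` of `M(X, 𝔤)^Γ` as a homomorphism: the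
evaluation map followed by the outer tensor product of the representations `V x` of `𝔤^x`. -/
def evalRep : EquivariantMapAlgebra k Γ A 𝔤 →ₗ⁅k⁆ Module.End k (⨂[k] x, V x) :=
  (outerTensorRep k (fun x : s => isotropyFixed Γ 𝔤 x.1) V).comp (evalMap k Γ A 𝔤 s)

/-- The underlying space `⨂_{x ∈ 𝐱} V x` of an evaluation representation. -/
def EvalModule {k A : Type*} [Field k] [CommRing A] [Algebra k A] (s : Finset (RatPoint k A))
    (V : s → Type*) [∀ x, AddCommGroup (V x)] [∀ x, Module k (V x)] : Type _ :=
  ⨂[k] x, V x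

instance EvalModule.instAddCommGroup : AddCommGroup (EvalModule s V) :=
  inferInstanceAs (AddCommGroup (⨂[k] x, V x))

instance EvalModule.instModule : Module k (EvalModule s V) :=
  inferInstanceAs (Module k (⨂[k] x, V x))

instance EvalModule.instLieRingModule :
    LieRingModule (EquivariantMapAlgebra k Γ A 𝔤) (EvalModule s V) :=
  LieRingModule.compLieHom (⨂[k] x, V x) (evalRep k Γ A 𝔤 s V)

instance EvalModule.instLieModule :
    LieModule k (EquivariantMapAlgebra k Γ A 𝔤) (EvalModule s V) :=
  LieModule.compLieHom (⨂[k] x, V x) (evalRep k Γ A 𝔤 s V)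

theorem EvalModule.lie_def (α : EquivariantMapAlgebra k Γ A 𝔤) (v : EvalModule s V) :
    ⁅α, v⁆ = evalRep k Γ A 𝔤 s V α v := rfl

variable {k A} in
/-- The support of an evaluation representation: the union of the orbits `Γ · x`, over those
`x ∈ 𝐱` for which `V x` is not the one-dimensional trivial representation of `𝔤^x`. -/
def evalSupport : Set (RatPoint k A) :=
  {y | ∃ x : s, ¬ (Module.finrank k (V x) = 1 ∧
    LieModule.IsTrivial (isotropyFixed Γ 𝔤 x.1) (V x)) ∧ ∃ γ : Γ, ratPointAct Γ γ x.1 = y}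

end EquivariantMapAlgebra

end

/-! The supports are disjoint, finite and `Γ`-stable, so some invariant function `r` is 0 on the
first and 1 on the second (`exists_invariant_separating`). The ideals `P` and `Q` of multiples of
`r` and `1 - r` in the equivariant map algebra `L` then satisfy `P + Q = L`, and annihilate `V₁` and
`V₂` respectively (`lie_evalModule_eq_zero`).

Write `V`, `W` for the two modules, let `U` be an extension of `V` by `W`, and put `N = P ⊓ Q`.
Since `P` sends `U` into `W` and `Q` kills `W`, the bracket `⁅N, N⁆` kills `U`. Extracting factors
`r` and `1 - r` gives `⁅P, ⁅Q, N⁆⁆ ≤ ⁅N, N⁆` (`lie_lie_mem_invariantMultiples_inf`), and this forces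
`N` itself to kill `U`. Hence `P` kills `⁅Q, U⁆`. This submodule maps onto `V`, because `⁅Q, V⁆ =
V`, and meets `W` in 0, because no nonzero vector of `W` is killed by `P`. It is therefore a
complement of `W`. -/

/-! ### Splitting extensions of modules annihilated by comaximal ideals -/

section Splitting

variable {k L : Type*} [Field k] [LieRing L] [LieAlgebra k L]
variable {V : Type*} [AddCommGroup V] [Module k V] [LieRingModule L V] [LieModule k L V]
variable {W : Type*} [AddCommGroup W] [Module k W] [LieRingModule L W] [LieModule k L W]

/-- An extension in which the submodule `W` has a complement is split. -/
theorem LieModExt.equivalent_split_of_isCompl (E : LieModExt k L V W) (C : LieSubmodule k L E.U)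
    (hsurj : ∀ v, ∃ c ∈ C, E.proj c = v) (hinj : ∀ w, E.incl w ∈ C → w = 0) :
    E.Equivalent (LieModExt.split k L V W) := by
  have hker : ∀ c ∈ C, E.proj c = 0 → c = 0 := by
    intro c hc h
    obtain ⟨w, rfl⟩ := (E.exact c).1 h
    rw [hinj w hc, map_zero]
  choose σ hσC hσ using hsurj
  -- `C` meets the kernel of `proj` only in 0, so lifts to `C` are unique; this is what makes the
  -- arbitrarily chosen section `σ` linear and equivariant.
  have huniq : ∀ c ∈ C, ∀ v, E.proj c = v → c = σ v := by
    intro c hc v h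
    refine sub_eq_zero.1 (hker _ (C.sub_mem hc (hσC v)) ?_)
    rw [map_sub, h, hσ, sub_self]
  let f : (V × W) →ₗ⁅k,L⁆ E.U :=
    { toFun := fun p => σ p.1 + E.incl p.2
      map_add' := fun p q => by
        have : σ p.1 + σ q.1 = σ (p.1 + q.1) :=
          huniq _ (C.add_mem (hσC _) (hσC _)) _ (by rw [map_add, hσ, hσ])
        simp only [Prod.fst_add, Prod.snd_add, map_add, ← this]
        abel
      map_smul' := fun c p => by
        have : c • σ p.1 = σ (c • p.1) :=
          huniq _ (C.smul_mem c (hσC _)) _ (by rw [map_smul, hσ])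
        simp only [Prod.smul_fst, Prod.smul_snd, map_smul, ← this, smul_add, RingHom.id_apply]
      map_lie' := fun {l p} => by
        have : ⁅l, σ p.1⁆ = σ ⁅l, p.1⁆ :=
          huniq _ (C.lie_mem (hσC _)) _ (by rw [LieModuleHom.map_lie, hσ])
        change σ ⁅l, p.1⁆ + E.incl ⁅l, p.2⁆ = ⁅l, σ p.1 + E.incl p.2⁆
        rw [lie_add, this, LieModuleHom.map_lie] }
  have hf : ∀ p, f p = σ p.1 + E.incl p.2 := fun _ => rfl
  have hproj : ∀ p, E.proj (f p) = p.1 := fun p => by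
    rw [hf, map_add, hσ, (E.exact _).2 ⟨_, rfl⟩, add_zero]
  have hσ0 : σ 0 = 0 := (huniq 0 C.zero_mem 0 (map_zero _)).symm
  have hbij : Function.Bijective f := by
    constructor
    · refine (injective_iff_map_eq_zero f).2 fun p hp => ?_
      have h1 : p.1 = 0 := by rw [← hproj p, hp, map_zero]
      refine Prod.ext h1 (E.incl_injective ?_)
      rw [hf, h1, hσ0, zero_add] at hp
      rw [hp, Prod.snd_zero, map_zero]
    · intro u
      obtain ⟨w, hw⟩ := (E.exact (u - σ (E.proj u))).1 (by rw [map_sub, hσ, sub_self])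
      exact ⟨(E.proj u, w), by rw [hf, hw]; abel⟩
  let e : (V × W) ≃ₗ⁅k,L⁆ E.U :=
    { f with
      invFun := (LinearEquiv.ofBijective f.toLinearMap hbij).symm
      left_inv := (LinearEquiv.ofBijective f.toLinearMap hbij).left_inv
      right_inv := (LinearEquiv.ofBijective f.toLinearMap hbij).right_inv }
  have hef : ∀ p, e p = f p := fun _ => rfl
  refine equivalent_equivalence.symm ⟨e, fun w => ?_, fun p => ?_⟩
  · change e (0, w) = _
    rw [hef, hf, hσ0, zero_add]
  · exact hproj p

/-- Let `P` and `Q` be comaximal ideals of `L` annihilating the nontrivial irreducible modules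
`V` and `W` respectively. If `⁅P, ⁅Q, P ⊓ Q⁆⁆ ≤ ⁅P ⊓ Q, P ⊓ Q⁆`, then every extension of `V` by `W`
splits; a complement of `W` is `⁅Q, U⁆`. -/
theorem LieModExt.equivalent_split_of_comaximal (P Q : LieIdeal k L)
    (hPQ : ∀ l : L, ∃ p ∈ P, ∃ q ∈ Q, p + q = l)
    (hN : ∀ p ∈ P, ∀ q ∈ Q, ∀ n ∈ P ⊓ Q, ⁅p, ⁅q, n⁆⁆ ∈ ⁅P ⊓ Q, P ⊓ Q⁆)
    (hP : ∀ p ∈ P, ∀ v : V, ⁅p, v⁆ = 0) (hQ : ∀ q ∈ Q, ∀ w : W, ⁅q, w⁆ = 0)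
    [LieModule.IsIrreducible k L V] [LieModule.IsIrreducible k L W]
    (hV : ¬ LieModule.IsTrivial L V) (hW : ¬ LieModule.IsTrivial L W)
    (E : LieModExt k L V W) : E.Equivalent (LieModExt.split k L V W) := by
  have hPE : ∀ p ∈ P, ∀ u : E.U, ∃ w, E.incl w = ⁅p, u⁆ := fun p hp u =>
    (E.exact _).1 (by rw [LieModuleHom.map_lie, hP p hp])
  have hQE : ∀ q ∈ Q, ∀ w, ⁅q, E.incl w⁆ = 0 := fun q hq w => by
    rw [← LieModuleHom.map_lie, hQ q hq, map_zero]
  -- As `Q` already kills `W`, a vector killed by `P` is `L`-invariant, and a nontrivial irreducible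
  -- module has no nonzero invariants.
  have hWP : ∀ w : W, (∀ p ∈ P, ⁅p, w⁆ = 0) → w = 0 := by
    intro w hw
    have hmax : LieModule.maxTrivSubmodule k L W = ⊥ := by
      refine (eq_bot_or_eq_top _).resolve_right fun h => hW ?_
      exact (LieModule.isTrivial_iff_max_triv_eq_top k L W).2 h
    have : w ∈ LieModule.maxTrivSubmodule k L W := by
      rw [LieModule.mem_maxTrivSubmodule]
      intro l
      obtain ⟨p, hp, q, hq, rfl⟩ := hPQ l
      rw [add_lie, hw p hp, hQ q hq, add_zero]
    rwa [hmax, LieSubmodule.mem_bot] at this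
  have hWP' : ∀ w : W, (∀ p ∈ P, ⁅p, E.incl w⁆ = 0) → E.incl w = 0 := fun w hw => by
    rw [hWP w fun p hp => E.incl_injective (by rw [LieModuleHom.map_lie, hw p hp, map_zero]),
      map_zero]
  -- Otherwise `Q`, like `P`, would kill `V`, making it trivial.
  have hQV : ⁅Q, (⊤ : LieSubmodule k L V)⁆ = ⊤ := by
    refine (eq_bot_or_eq_top _).resolve_left fun h => hV ⟨fun l v => ?_⟩
    obtain ⟨p, hp, q, hq, rfl⟩ := hPQ l
    have := LieSubmodule.lie_mem_lie hq (LieSubmodule.mem_top (R := k) (L := L) v)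
    rw [h, LieSubmodule.mem_bot] at this
    rw [add_lie, hP p hp, this, add_zero]
  have hsurj : ∀ v, ∃ c ∈ ⁅Q, (⊤ : LieSubmodule k L E.U)⁆, E.proj c = v := by
    have hmap : (⁅Q, (⊤ : LieSubmodule k L E.U)⁆).map E.proj = ⊤ := by
      rw [LieSubmodule.map_bracket_eq, LieModuleHom.map_top,
        (LieModuleHom.range_eq_top _).2 E.proj_surjective, hQV]
    intro v
    exact (LieSubmodule.mem_map v).1 (hmap ▸ LieSubmodule.mem_top v)
  -- For `a`, `b` in `P ⊓ Q`, `b` pushes `U` into `W` and `a` then kills it, so both terms of the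
  -- commutator vanish.
  have hNN : ∀ n ∈ ⁅P ⊓ Q, P ⊓ Q⁆, ∀ u : E.U, ⁅n, u⁆ = 0 := by
    intro n hn u
    rw [← LieSubmodule.mem_toSubmodule, LieSubmodule.lieIdeal_oper_eq_linear_span'] at hn
    induction hn using Submodule.span_induction with
    | mem x hx =>
      obtain ⟨a, ha, b, hb, rfl⟩ := hx
      have h : ∀ a ∈ P ⊓ Q, ∀ b ∈ P ⊓ Q, ⁅a, ⁅b, u⁆⁆ = 0 := by
        intro a ha b hb
        obtain ⟨w, hw⟩ := hPE b hb.1 u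
        rw [← hw, hQE a ha.2]
      rw [lie_lie, h a ha b hb, h b hb a ha, sub_zero]
    | zero => exact zero_lie u
    | add x y _ _ hx hy => rw [add_lie, hx, hy, add_zero]
    | smul c x _ hx => rw [smul_lie, hx, smul_zero]
  have hNE : ∀ n ∈ P ⊓ Q, ∀ u : E.U, ⁅n, u⁆ = 0 := by
    intro n hn
    have hn' : ∀ q ∈ Q, ∀ u : E.U, ⁅n, ⁅q, u⁆⁆ = 0 := by
      intro q hq u
      obtain ⟨w, hw⟩ := hPE n hn.1 ⁅q, u⁆
      rw [← hw]
      refine hWP' w fun p hp => ?_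
      -- Expand `⁅p, ⁅q, n⁆⁆` on `u` into four terms. In three of them the first two operators
      -- applied already give 0, since `p` and `n` map into `W`, which `q` and `n` kill. Only `p n q
      -- u` survives, so `P` kills the vector `n q u` of `W`.
      have h0 := hNN _ (hN p hp q hq n hn) u
      obtain ⟨w₁, hw₁⟩ := hPE p hp u
      obtain ⟨w₂, hw₂⟩ := hPE n hn.1 u
      rw [lie_lie, lie_lie q n u, ← hw₁, lie_lie q n, hQE n hn.2, hQE q hq, ← hw₂, hQE q hq,
        ← hw] at h0
      simpa using h0
    intro u
    -- `U` is the sum of `⁅Q, U⁆` and `W`, and `n` kills both.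
    obtain ⟨c, hc, hcu⟩ := hsurj (E.proj u)
    obtain ⟨w, hw⟩ := (E.exact (u - c)).1 (by rw [map_sub, hcu, sub_self])
    have hnc : ⁅n, c⁆ = 0 := by
      rw [← LieSubmodule.mem_toSubmodule, LieSubmodule.lieIdeal_oper_eq_linear_span'] at hc
      clear hcu hw
      induction hc using Submodule.span_induction with
      | mem x hx =>
        obtain ⟨q, hq, u, -, rfl⟩ := hx
        exact hn' q hq u
      | zero => exact lie_zero n
      | add x y _ _ hx hy => rw [lie_add, hx, hy, add_zero]
      | smul c x _ hx => rw [lie_smul, hx, smul_zero]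
    rw [← sub_add_cancel u c, lie_add, ← hw, hQE n hn.2, hnc, add_zero]
  have hPQE : ∀ p ∈ P, ∀ c ∈ ⁅Q, (⊤ : LieSubmodule k L E.U)⁆, ⁅p, c⁆ = 0 := by
    intro p hp c hc
    rw [← LieSubmodule.mem_toSubmodule, LieSubmodule.lieIdeal_oper_eq_linear_span'] at hc
    induction hc using Submodule.span_induction with
    | mem x hx =>
      obtain ⟨q, hq, u, -, rfl⟩ := hx
      obtain ⟨w, hw⟩ := hPE p hp u
      have hpq : ⁅p, q⁆ ∈ P ⊓ Q := ⟨lie_mem_left k L P p q hp, lie_mem_right k L Q p q hq⟩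
      -- `p q u = ⁅p, q⁆ u + q p u`: the first term vanishes because `P ⊓ Q` kills `U`, the second
      -- because `p u` lies in `W`.
      rw [leibniz_lie, hNE _ hpq, ← hw, hQE q hq, add_zero]
    | zero => exact lie_zero p
    | add x y _ _ hx hy => rw [lie_add, hx, hy, add_zero]
    | smul c x _ hx => rw [lie_smul, hx, smul_zero]
  refine E.equivalent_split_of_isCompl _ hsurj fun w hw => E.incl_injective ?_
  rw [map_zero]
  exact hWP' w fun p hp => hPQE p hp _ hw

end Splitting

/-! ### Outer tensor products of zero actions -/

section OuterTensorZero

attribute [local instance 100] LieRing.ofAssociativeRing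

variable {k ι : Type*} [Field k] {V : ι → Type*} [∀ i, AddCommGroup (V i)] [∀ i, Module k (V i)]

theorem PiTensorProduct.mapAt_zero (i : ι) : PiTensorProduct.mapAt k V i 0 = 0 := by
  classical exact (PiTensorProduct.mapMultilinear k V V).map_update_zero _ _

theorem outerTensorRep_eq_zero [Fintype ι] {L : ι → Type*} [∀ i, LieRing (L i)]
    [∀ i, LieAlgebra k (L i)] [∀ i, LieRingModule (L i) (V i)] [∀ i, LieModule k (L i) (V i)]
    {l : ∀ i, L i} (h : ∀ i, LieModule.toEnd k (L i) (V i) (l i) = 0) :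
    outerTensorRep k L V l = 0 :=
  Finset.sum_eq_zero fun i _ => by rw [h i, PiTensorProduct.mapAt_zero]

end OuterTensorZero

/-! ### Multiples of invariant functions in an equivariant map algebra -/

section InvariantMultiples

attribute [local instance 100] LieRing.ofAssociativeRing

variable {k Γ A 𝔤 : Type*} [Field k] [Group Γ]
  [CommRing A] [Algebra k A] [MulSemiringAction Γ A] [SMulCommClass Γ k A]
  [LieRing 𝔤] [LieAlgebra k 𝔤] [DistribMulAction Γ 𝔤] [SMulCommClass Γ k 𝔤] [LieMulAction Γ 𝔤]

theorem mapAlgebraAct_smul (γ : Γ) (r : A) (α : A ⊗[k] 𝔤) :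
    mapAlgebraAct k A 𝔤 γ (r • α) = (γ • r) • mapAlgebraAct k A 𝔤 γ α := by
  have h (a : A) (u : 𝔤) :
      mapAlgebraAct k A 𝔤 γ (a ⊗ₜ[k] u) = (γ • a) ⊗ₜ[k] (γ • u) := rfl
  induction α with
  | zero => simp
  | add α β hα hβ => rw [smul_add, map_add, hα, hβ, map_add, smul_add]
  | tmul a u => rw [TensorProduct.smul_tmul', h, h, TensorProduct.smul_tmul', smul_eq_mul,
      smul_mul', smul_eq_mul]

theorem evalPoint_smul (x : RatPoint k A) (r : A) (α : A ⊗[k] 𝔤) :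
    evalPoint 𝔤 x (r • α) = x r • evalPoint 𝔤 x α := by
  induction α with
  | zero => simp
  | add α β hα hβ => rw [smul_add, map_add, hα, hβ, map_add, smul_add]
  | tmul a u => rw [TensorProduct.smul_tmul', evalPoint_tmul, evalPoint_tmul, smul_eq_mul, map_mul,
      mul_smul]

theorem smul_mem_equivariantMapAlgebra {r : A} (hr : ∀ γ : Γ, γ • r = r) {α : A ⊗[k] 𝔤}
    (hα : α ∈ EquivariantMapAlgebra k Γ A 𝔤) : r • α ∈ EquivariantMapAlgebra k Γ A 𝔤 := fun γ => by
  rw [mapAlgebraAct_smul, hr, hα γ]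

variable (k Γ 𝔤) in
/-- The ideal of multiples of an invariant function in an equivariant map algebra. -/
def invariantMultiples (r : A) : LieIdeal k (EquivariantMapAlgebra k Γ A 𝔤) where
  carrier := {α | ∃ β : EquivariantMapAlgebra k Γ A 𝔤, (α : A ⊗[k] 𝔤) = r • (β : A ⊗[k] 𝔤)}
  zero_mem' := ⟨0, (smul_zero r).symm⟩
  add_mem' := by
    rintro _ _ ⟨β, hβ⟩ ⟨β', hβ'⟩
    exact ⟨β + β', (congrArg₂ (· + ·) hβ hβ').trans (smul_add ..).symm⟩
  smul_mem' := by
    rintro c _ ⟨β, hβ⟩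
    exact ⟨c • β, (congrArg (c • ·) hβ).trans (smul_comm ..)⟩
  lie_mem := by
    rintro α _ ⟨β, hβ⟩
    exact ⟨⁅α, β⁆, by rw [LieSubalgebra.coe_bracket, hβ, LieSubalgebra.coe_bracket, lie_smul]⟩

theorem exists_add_mem_invariantMultiples {r s : A} (hr : ∀ γ : Γ, γ • r = r)
    (hs : ∀ γ : Γ, γ • s = s) (hrs : r + s = 1) (α : EquivariantMapAlgebra k Γ A 𝔤) :
    ∃ p ∈ invariantMultiples k Γ 𝔤 r, ∃ q ∈ invariantMultiples k Γ 𝔤 s, p + q = α :=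
  ⟨⟨_, smul_mem_equivariantMapAlgebra hr α.2⟩, ⟨α, rfl⟩,
    ⟨_, smul_mem_equivariantMapAlgebra hs α.2⟩, ⟨α, rfl⟩,
    Subtype.ext ((add_smul ..).symm.trans (by rw [hrs, one_smul]))⟩

/-- Comaximality turns the intersection into multiples of the product: if `α = r β = s β'`, then `α
= (r + s) α = r s (β' + β)`. -/
theorem mem_invariantMultiples_inf {r s : A} (hr : ∀ γ : Γ, γ • r = r) (hs : ∀ γ : Γ, γ • s = s)
    (hrs : r + s = 1) {α : EquivariantMapAlgebra k Γ A 𝔤} :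
    α ∈ invariantMultiples k Γ 𝔤 r ⊓ invariantMultiples k Γ 𝔤 s ↔
      ∃ β : EquivariantMapAlgebra k Γ A 𝔤, (α : A ⊗[k] 𝔤) = (r * s) • (β : A ⊗[k] 𝔤) := by
  constructor
  · rintro ⟨⟨β, hβ⟩, ⟨β', hβ'⟩⟩
    refine ⟨β' + β, ?_⟩
    calc (α : A ⊗[k] 𝔤) = (r + s) • (α : A ⊗[k] 𝔤) := by rw [hrs, one_smul]
      _ = r • s • (β' : A ⊗[k] 𝔤) + s • r • (β : A ⊗[k] 𝔤) := by rw [add_smul, ← hβ, ← hβ']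
      _ = (r * s) • ((β' : A ⊗[k] 𝔤) + (β : A ⊗[k] 𝔤)) := by
        rw [smul_smul, smul_smul, mul_comm s r, ← smul_add]
  · rintro ⟨β, hβ⟩
    exact ⟨⟨⟨_, smul_mem_equivariantMapAlgebra hs β.2⟩, by rw [hβ, mul_smul]⟩,
      ⟨⟨_, smul_mem_equivariantMapAlgebra hr β.2⟩, by rw [hβ, mul_comm, mul_smul]⟩⟩

/-- With `p = r a`, `q = s b` and `n = r s c`, the double bracket carries the scalar `(r s)²`, which
can be redistributed as `⁅r s a, r s ⁅b, c⁆⁆`. -/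
theorem lie_lie_mem_invariantMultiples_inf {r s : A} (hr : ∀ γ : Γ, γ • r = r)
    (hs : ∀ γ : Γ, γ • s = s) (hrs : r + s = 1) {p q n : EquivariantMapAlgebra k Γ A 𝔤}
    (hp : p ∈ invariantMultiples k Γ 𝔤 r) (hq : q ∈ invariantMultiples k Γ 𝔤 s)
    (hn : n ∈ invariantMultiples k Γ 𝔤 r ⊓ invariantMultiples k Γ 𝔤 s) :
    ⁅p, ⁅q, n⁆⁆ ∈ ⁅invariantMultiples k Γ 𝔤 r ⊓ invariantMultiples k Γ 𝔤 s,
        invariantMultiples k Γ 𝔤 r ⊓ invariantMultiples k Γ 𝔤 s⁆ := by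
  obtain ⟨a, ha⟩ := hp
  obtain ⟨b, hb⟩ := hq
  obtain ⟨c, hc⟩ := (mem_invariantMultiples_inf hr hs hrs).1 hn
  have hrs' : ∀ γ : Γ, γ • (r * s) = r * s := fun γ => by rw [smul_mul', hr, hs]
  let m (α : EquivariantMapAlgebra k Γ A 𝔤) : EquivariantMapAlgebra k Γ A 𝔤 :=
    ⟨_, smul_mem_equivariantMapAlgebra hrs' α.2⟩
  have hm (α) : m α ∈ invariantMultiples k Γ 𝔤 r ⊓ invariantMultiples k Γ 𝔤 s :=
    (mem_invariantMultiples_inf hr hs hrs).2 ⟨α, rfl⟩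
  have h : ⁅p, ⁅q, n⁆⁆ = ⁅m a, m ⁅b, c⁆⁆ := by
    apply Subtype.ext
    change ⁅(p : A ⊗[k] 𝔤), ⁅(q : A ⊗[k] 𝔤), (n : A ⊗[k] 𝔤)⁆⁆ =
      ⁅(r * s) • (a : A ⊗[k] 𝔤), (r * s) • ⁅(b : A ⊗[k] 𝔤), (c : A ⊗[k] 𝔤)⁆⁆
    simp only [ha, hb, hc, smul_lie, lie_smul, smul_smul]
    congr 1
    ring
  rw [h]
  exact LieSubmodule.lie_mem_lie (hm a) (hm _)

theorem ratPointAct_one (x : RatPoint k A) : ratPointAct Γ 1 x = x :=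
  AlgHom.ext fun a => by
    change x ((1 : Γ)⁻¹ • a) = x a
    rw [inv_one, one_smul]

theorem ratPointAct_mul (γ δ : Γ) (x : RatPoint k A) :
    ratPointAct Γ γ (ratPointAct Γ δ x) = ratPointAct Γ (γ * δ) x :=
  AlgHom.ext fun a => by
    change x (δ⁻¹ • γ⁻¹ • a) = x ((γ * δ)⁻¹ • a)
    rw [smul_smul, mul_inv_rev]

variable (s : Finset (RatPoint k A)) (V : s → Type*) [∀ x, AddCommGroup (V x)]
  [∀ x, Module k (V x)] [∀ x : s, LieRingModule (isotropyFixed Γ 𝔤 x.1) (V x)]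

variable (Γ 𝔤) in
theorem ratPointAct_mem_evalSupport (γ : Γ) {y : RatPoint k A}
    (hy : y ∈ evalSupport Γ 𝔤 s V) : ratPointAct Γ γ y ∈ evalSupport Γ 𝔤 s V := by
  obtain ⟨x, hx, δ, rfl⟩ := hy
  exact ⟨x, hx, γ * δ, (ratPointAct_mul γ δ x.1).symm⟩

variable (Γ 𝔤) in
theorem finite_evalSupport [Finite Γ] : (evalSupport Γ 𝔤 s V).Finite := by
  refine (Set.finite_range fun p : s × Γ => ratPointAct Γ p.2 p.1.1).subset ?_
  rintro y ⟨x, -, γ, rfl⟩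
  exact ⟨(x, γ), rfl⟩

variable [∀ x : s, LieModule k (isotropyFixed Γ 𝔤 x.1) (V x)]

/-- Functions vanishing on the support of an evaluation module annihilate it. -/
theorem lie_evalModule_eq_zero {r : A} (hr : ∀ y ∈ evalSupport Γ 𝔤 s V, y r = 0)
    {p : EquivariantMapAlgebra k Γ A 𝔤} (hp : p ∈ invariantMultiples k Γ 𝔤 r)
    (v : EvalModule s V) : ⁅p, v⁆ = 0 := by
  obtain ⟨β, hβ⟩ := hp
  have h0 : evalRep k Γ A 𝔤 s V p = 0 := by
    refine outerTensorRep_eq_zero fun x => ?_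
    -- A trivial factor contributes 0 whatever the value of `r` at `x`; every other `x` lies in the
    -- support, where `r` vanishes.
    by_cases hV : Module.finrank k (V x) = 1 ∧ LieModule.IsTrivial (isotropyFixed Γ 𝔤 x.1) (V x)
    · have := hV.2
      exact LinearMap.ext fun v => LieModule.IsTrivial.trivial _ v
    · have : evalMap k Γ A 𝔤 s p x = 0 := by
        apply Subtype.ext
        change evalPoint 𝔤 x.1 (p : A ⊗[k] 𝔤) = 0
        rw [hβ, evalPoint_smul, hr x.1 ⟨x, hV, 1, ratPointAct_one x.1⟩, zero_smul]
      exact (congrArg (LieModule.toEnd k _ (V x)) this).trans (map_zero _)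
  rw [EvalModule.lie_def, h0]
  rfl

end InvariantMultiples

/-! ### Separating finite sets of rational points by functions -/

section Separation

variable {k A : Type*} [Field k] [CommRing A] [Algebra k A]

theorem exists_ratPoint_eq_zero_eq_one {x y : RatPoint k A} (h : x ≠ y) :
    ∃ a : A, x a = 0 ∧ y a = 1 := by
  obtain ⟨b, hb⟩ := DFunLike.ne_iff.1 h
  refine ⟨(y b - x b)⁻¹ • (b - algebraMap k A (x b)), ?_, ?_⟩
  · simp
  · simp only [map_smul, map_sub, AlgHom.commutes, smul_eq_mul]
    exact inv_mul_cancel₀ (sub_ne_zero.2 hb.symm)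

theorem exists_ratPoint_separating {S T : Set (RatPoint k A)} (hS : S.Finite) (hT : T.Finite)
    (h : Disjoint S T) : ∃ a : A, (∀ x ∈ S, x a = 0) ∧ ∀ y ∈ T, y a = 1 := by
  classical
  have hST : ∀ x y, ∃ a : A, x ∈ S → y ∈ T → x a = 0 ∧ y a = 1 := by
    intro x y
    by_cases hxy : x ∈ S ∧ y ∈ T
    · obtain ⟨a, ha⟩ := exists_ratPoint_eq_zero_eq_one (h.ne_of_mem hxy.1 hxy.2)
      exact ⟨a, fun _ _ => ha⟩
    · exact ⟨0, fun hx hy => absurd ⟨hx, hy⟩ hxy⟩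
  choose a ha using hST
  -- For each `y`, the inner product is 0 on `S` and 1 at `y`; the outer expression combines these
  -- into one function equal to 1 on all of `T`.
  refine ⟨1 - ∏ y ∈ hT.toFinset, (1 - ∏ x ∈ hS.toFinset, a x y), fun x hx => ?_, fun y hy => ?_⟩
  · rw [map_sub, map_one, map_prod, Finset.prod_eq_one, sub_self]
    intro y hy
    rw [map_sub, map_one, map_prod, Finset.prod_eq_zero (hS.mem_toFinset.2 hx), sub_zero]
    exact (ha x y hx (hT.mem_toFinset.1 hy)).1
  · rw [map_sub, map_one, map_prod, Finset.prod_eq_zero (hT.mem_toFinset.2 hy), sub_zero]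
    rw [map_sub, map_one, map_prod, Finset.prod_eq_one, sub_self]
    intro x hx
    exact (ha x y (hS.mem_toFinset.1 hx) hy).2

variable {Γ : Type*} [Group Γ] [Finite Γ] [MulSemiringAction Γ A] [SMulCommClass Γ k A]

/-- Disjoint finite `Γ`-stable sets of rational points are separated by an invariant function. -/
theorem exists_invariant_separating {S T : Set (RatPoint k A)} (hS : S.Finite) (hT : T.Finite)
    (h : Disjoint S T) (hΓS : ∀ γ : Γ, ∀ x ∈ S, ratPointAct Γ γ x ∈ S)
    (hΓT : ∀ γ : Γ, ∀ x ∈ T, ratPointAct Γ γ x ∈ T) :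
    ∃ r : A, (∀ γ : Γ, γ • r = r) ∧ (∀ x ∈ S, x r = 0) ∧ ∀ y ∈ T, y r = 1 := by
  have := Fintype.ofFinite Γ
  obtain ⟨a, haS, haT⟩ := exists_ratPoint_separating hS hT h
  have hact (γ : Γ) (x : RatPoint k A) : x (γ • a) = ratPointAct Γ γ⁻¹ x a := by
    change _ = x (γ⁻¹⁻¹ • a)
    rw [inv_inv]
  -- The norm of `a` over `Γ` is invariant, and stability of `S` and `T` preserves the values 0 and
  -- 1.
  refine ⟨∏ γ : Γ, γ • a, fun δ => ?_, fun x hx => ?_, fun y hy => ?_⟩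
  · rw [Finset.smul_prod']
    simp only [smul_smul]
    exact (Group.mulLeft_bijective δ).prod_comp fun γ => γ • a
  · rw [map_prod]
    exact Finset.prod_eq_zero (Finset.mem_univ 1) (by rw [hact, haS _ (hΓS _ _ hx)])
  · rw [map_prod]
    exact Finset.prod_eq_one fun γ _ => by rw [hact, haT _ (hΓT _ _ hy)]

end Separation

/-! ### Vanishing of `Ext¹` for disjoint supports -/

theorem proposition3p7
    {k : Type*} [Field k] [IsAlgClosed k] [CharZero k]
    {Γ : Type*} [Group Γ] [Finite Γ]
    {A : Type*} [CommRing A] [Algebra k A] [Algebra.FiniteType k A]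
    [MulSemiringAction Γ A] [SMulCommClass Γ k A]
    {𝔤 : Type*} [LieRing 𝔤] [LieAlgebra k 𝔤] [FiniteDimensional k 𝔤]
    [LieAlgebra.HasCentralRadical k 𝔤]
    [DistribMulAction Γ 𝔤] [SMulCommClass Γ k 𝔤] [LieMulAction Γ 𝔤]
    (s₁ : Finset (RatPoint k A)) (hs₁ : OrbitDistinct Γ s₁)
    (V₁ : s₁ → Type*) [∀ x, AddCommGroup (V₁ x)] [∀ x, Module k (V₁ x)]
    [∀ x, FiniteDimensional k (V₁ x)]
    [∀ x : s₁, LieRingModule (isotropyFixed Γ 𝔤 x.1) (V₁ x)]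
    [∀ x : s₁, LieModule k (isotropyFixed Γ 𝔤 x.1) (V₁ x)]
    (s₂ : Finset (RatPoint k A)) (hs₂ : OrbitDistinct Γ s₂)
    (V₂ : s₂ → Type*) [∀ x, AddCommGroup (V₂ x)] [∀ x, Module k (V₂ x)]
    [∀ x, FiniteDimensional k (V₂ x)]
    [∀ x : s₂, LieRingModule (isotropyFixed Γ 𝔤 x.1) (V₂ x)]
    [∀ x : s₂, LieModule k (isotropyFixed Γ 𝔤 x.1) (V₂ x)]
    (hirr₁ : LieModule.IsIrreducible k (EquivariantMapAlgebra k Γ A 𝔤) (EvalModule s₁ V₁))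
    (hirr₂ : LieModule.IsIrreducible k (EquivariantMapAlgebra k Γ A 𝔤) (EvalModule s₂ V₂))
    (hnt₁ : ¬ LieModule.IsTrivial (EquivariantMapAlgebra k Γ A 𝔤) (EvalModule s₁ V₁))
    (hnt₂ : ¬ LieModule.IsTrivial (EquivariantMapAlgebra k Γ A 𝔤) (EvalModule s₂ V₂))
    (hsupp : Disjoint (evalSupport Γ 𝔤 s₁ V₁) (evalSupport Γ 𝔤 s₂ V₂)) :
    ∀ e : LieExtOne k (EquivariantMapAlgebra k Γ A 𝔤) (EvalModule s₁ V₁) (EvalModule s₂ V₂),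
      e = 0 := by
  have hf₁ := finite_evalSupport Γ 𝔤 s₁ V₁
  have hf₂ := finite_evalSupport Γ 𝔤 s₂ V₂
  obtain ⟨r, hr, hr₁, hr₂⟩ := exists_invariant_separating hf₁ hf₂ hsupp
    (fun γ _ => ratPointAct_mem_evalSupport Γ 𝔤 s₁ V₁ γ)
    (fun γ _ => ratPointAct_mem_evalSupport Γ 𝔤 s₂ V₂ γ)
  have hs : ∀ γ : Γ, γ • (1 - r) = 1 - r := fun γ => by rw [smul_sub, smul_one, hr]
  have hrs : r + (1 - r) = 1 := add_sub_cancel r 1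
  refine Quotient.ind fun E => Quotient.sound ?_
  exact E.equivalent_split_of_comaximal (invariantMultiples k Γ 𝔤 r)
    (invariantMultiples k Γ 𝔤 (1 - r)) (exists_add_mem_invariantMultiples hr hs hrs)
    (fun p hp q hq n hn => lie_lie_mem_invariantMultiples_inf hr hs hrs hp hq hn)
    (fun p hp => lie_evalModule_eq_zero s₁ V₁ hr₁ hp)
    (fun q hq => lie_evalModule_eq_zero s₂ V₂
      (fun y hy => by rw [map_sub, map_one, hr₂ y hy, sub_self]) hq)
    hnt₁ hnt₂
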